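/- Let $n\ge 1$ be an integer, let $0<\alpha\le 22/35$, and let $M$ be a probability distribution on $\{1,2,\dots\}$ with $\mathbb{E}_{m\sim M}[m]<\infty$. For a probability distribution $\mu$ on $[-1,1]$ with mean $\theta(\mu)$, let $\nu_\mu$ be the law on $\mathcal{X}=\bigcup_{m\ge 1}[-1,1]^m$ (a disjoint union) of a data set of random size $m\sim M$ which, given $m$, consists of $m$ independent samples from $\mu$. Users $1,\dots,n$ hold independent data sets $X^{(1)},\dots,X^{(n)}\sim\nu_\mu$. A (sequentially interactive, user-level) $\alpha$-LDP mechanism $Q$ with values in a measurable space $(\mathcal{Z},\mathfrak{Z})$ consists of Markov kernels $Q_u(\cdot\mid x,z_{1:u-1})$, $1\le u\le n$, from $\mathcal{X}\times\mathcal{Z}^{u-1}$ to $\mathcal{Z}$ such that $Q_u(S\mid x,z_{1:u-1})\le e^{\alpha}\,Q_u(S\mid x',z_{1:u-1})$ for all $x,x'\in\mathcal{X}$, $z_{1:u-1}\in\mathcal{Z}^{u-1}$ and $S\in\mathfrak{Z}$; the releases $Z^{(u)}$ are drawn successively from $Q_u(\cdot\mid X^{(u)},Z^{(1:u-1)})$.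 Let $$R_{\alpha,n,M}=\inf_{Q,\hat\theta}\ \sup_{\mu}\ \mathbb{E}\Big[\big|\hat\theta(Z^{(1)},\dots,Z^{(n)})-\theta(\mu)\big|^2\Big],$$ where the infimum is over all $\alpha$-LDP mechanisms $Q$ (with arbitrary $\mathcal{Z}$) and all measurable estimators $\hat\theta:\mathcal{Z}^n\to\mathbb{R}$, and the supremum is over all probability distributions $\mu$ on $[-1,1]$. Then, with $c_1=e^{-9}/16$ and $c_2=24$, $$R_{\alpha,n,M}\ \ge\ \sup_{a\in\{0,1,2,\dots\}}\ \frac{c_1\exp\!\big(-c_2\,n\alpha^2\,\mathbb{P}_{m\sim M}(m>a)^2\big)}{\max\!\big(n\alpha^2\,\mathbb{E}_{m\sim M}[\sqrt m\,\mathbf{1}\{m\le a\}]^2,\ 1\big)}.$$ -/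

import Mathlib

open MeasureTheory ProbabilityTheory

universe u

noncomputable section

namespace UserLDP

/-- The range `[-1, 1]` of a single sample. -/
abbrev Sample : Type := Set.Icc (-1 : ℝ) 1

/-- The space of local data sets: the disjoint union over sizes `m ≥ 1` of `[-1, 1]^m`. -/
abbrev Dataset : Type := Σ m : ℕ+, (Fin (m : ℕ) → Sample)

/-- The law of one local data set: the size `m` is drawn from `M` and, given `m`, the data set
consists of `m` independent samples from `μ`. -/
def datasetLaw (M : PMF ℕ+) (μ : Measure Sample) : Measure Dataset :=
  Measure.sum fun m : ℕ+ =>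
    M m • (Measure.pi fun _ : Fin (m : ℕ) => μ).map
      (fun x : Fin (m : ℕ) → Sample => (⟨m, x⟩ : Dataset))

/-- The truncated moment `E[√m 1{m ≤ a}]` of the size distribution (a finite sum). -/
def truncSqrtMoment (M : PMF ℕ+) (a : ℕ) : ℝ :=
  ∑' m : ℕ+, (M m).toReal * (if (m : ℕ) ≤ a then Real.sqrt ((m : ℕ) : ℝ) else 0)

/-- The tail probability `P(m > a)` of the size distribution. -/
def tailProb (M : PMF ℕ+) (a : ℕ) : ℝ := (M.toOuterMeasure {m : ℕ+ | a < (m : ℕ)}).toReal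

/-- A sequentially interactive `α`-LDP mechanism for `n` users with private data in `X` and
releases in `Z`. The channel of user `u` is the conditional law of the release of `u` given the
data of `u` and the releases of the earlier users. -/
structure LDPMechanism (α : ℝ) (n : ℕ) (X : Type*) (Z : Type*)
    [MeasurableSpace X] [MeasurableSpace Z] where
  /-- The local channels. -/
  channel : (u : Fin n) → Kernel (X × (Fin (u : ℕ) → Z)) Z
  isMarkov : ∀ u, IsMarkovKernel (channel u)
  ldp : ∀ (u : Fin n) (z : Fin (u : ℕ) → Z) (x x' : X) (S : Set Z), MeasurableSet S →
    channel u (x, z) S ≤ ENNReal.ofReal (Real.exp α) * channel u (x', z) S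

variable {X Z : Type*} [MeasurableSpace X] [MeasurableSpace Z]

theorem measurable_init (n : ℕ) :
    Measurable (fun x : Fin (n + 1) → X => (fun i : Fin n => x i.castSucc)) := by
  fun_prop

theorem measurable_lastInput (n : ℕ) :
    Measurable (fun p : (Fin (n + 1) → X) × (Fin n → Z) => (p.1 (Fin.last n), p.2)) := by
  fun_prop

/-- The conditional law of all the releases `Z⁽¹⁾, …, Z⁽ⁿ⁾` given all the data sets
`X⁽¹⁾, …, X⁽ⁿ⁾`, for given local channels: the releases of the first `n` users depend on the data
of these users only, and the last release is drawn from the last channel, evaluated at the data of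
the last user and the earlier releases. -/
def releaseKernel : (n : ℕ) → ((u : Fin n) → Kernel (X × (Fin (u : ℕ) → Z)) Z) →
    Kernel (Fin n → X) (Fin n → Z)
  | 0, _ => Kernel.const _ (Measure.dirac Fin.elim0)
  | n + 1, Q =>
    (((releaseKernel n fun u => Q u.castSucc).comap _ (measurable_init n)) ⊗ₖ
      ((Q (Fin.last n)).comap _ (measurable_lastInput n))).map
        (fun p : (Fin n → Z) × Z => (Fin.snoc p.1 p.2 : Fin (n + 1) → Z))

/-- The law of the releases when the `n` local data sets are independent with law
`datasetLaw M μ`. -/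
def releaseLaw {α : ℝ} {n : ℕ} (Q : LDPMechanism α n Dataset Z) (M : PMF ℕ+)
    (μ : Measure Sample) : Measure (Fin n → Z) :=
  (Measure.pi fun _ : Fin n => datasetLaw M μ).bind (releaseKernel n Q.channel)

/-- The mean `θ` of the distribution `μ`. -/
def mean (μ : Measure Sample) : ℝ := ∫ x, (x : ℝ) ∂μ

/-- The quadratic risk of an estimator `est` based on the releases of the mechanism `Q`. -/
def risk {α : ℝ} {n : ℕ} (Q : LDPMechanism α n Dataset Z) (est : (Fin n → Z) → ℝ)
    (M : PMF ℕ+) (μ : Measure Sample) : ENNReal :=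
  ∫⁻ z, ENNReal.ofReal (|est z - mean μ| ^ 2) ∂(releaseLaw Q M μ)

/-- The minimax risk: infimum over release spaces, `α`-LDP mechanisms and measurable estimators of
the supremum of the risk over all probability distributions on `[-1, 1]`. -/
def minimaxRisk (α : ℝ) (n : ℕ) (M : PMF ℕ+) : ENNReal :=
  ⨅ (Z : Type u) (_ : MeasurableSpace Z) (Q : LDPMechanism α n Dataset Z)
    (est : (Fin n → Z) → ℝ) (_ : Measurable est),
    ⨆ μ : ProbabilityMeasure Sample, risk Q est M (μ : Measure Sample)

end UserLDP

end

/-! Le Cam's two-point method with the laws on {-1, 1} of means δ and -δ, where δ² = 1/(16B) and B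
is the maximum in the denominator. The squared affinity of the two laws is at least exp(-2(8δ/3)²).
It tensorizes, so data sets of size m are within √(2m)·8δ/3 in total variation; sizes above a get
the trivial bound 1. Averaging over m gives v = √2·(8δ/3)·T + p, with T the truncated moment and p
the tail (`AffinityBound.tvBound_datasetLaw`). A private channel turns total variation v into
likelihood ratios at most 1 + (e^α - 1)v (`TVBound.lintegral_le_of_ldp`), so each release costs a
factor exp(-2((e^α - 1)v)²) of affinity, and interaction does not spoil the product
(`affinityBound_bind_releaseKernel`). The risk is at least the final squared affinity times δ²
(`AffinityBound.le_of_risk_le`). Affinity is used in dual form: the bound then passes through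
iterated integrals and needs neither a dominating measure nor any structure on the release space. -/

noncomputable section

namespace UserLDP

/-! ### Affinity and total variation in dual form -/

/-- The squared Hellinger affinity of `P` and `Q` is at least `c`, in dual form. -/
def AffinityBound {Z : Type*} [MeasurableSpace Z] (c : ENNReal) (P Q : Measure Z) : Prop :=
  ∀ f g : Z → ENNReal, Measurable f → Measurable g → ∀ k : ENNReal, (∀ z, k ≤ f z * g z) →
    c * k ≤ (∫⁻ z, f z ∂P) * ∫⁻ z, g z ∂Q

/-- The total variation distance of `P` and `Q` is at most `V`, in dual form. -/
def TVBound {Z : Type*} [MeasurableSpace Z] (V : ENNReal) (P Q : Measure Z) : Prop :=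
  ∀ h : Z → ENNReal, Measurable h → (∀ z, h z ≤ 1) → ∫⁻ z, h z ∂P ≤ ∫⁻ z, h z ∂Q + V

theorem sq_rpow_half (x : ENNReal) : (x ^ (1 / 2 : ℝ)) ^ 2 = x := by
  rw [← ENNReal.rpow_natCast, ← ENNReal.rpow_mul]
  norm_num

/-- Cauchy–Schwarz for √(rf) and √g, whose product is at least √(kr). With r the density of P, the
usual squared affinity is thus an admissible constant in the dual form. -/
theorem sq_lintegral_rpow_half_mul_le {Z : Type*} [MeasurableSpace Z] {Q : Measure Z}
    {r f g : Z → ENNReal} (hr : Measurable r) (hf : Measurable f) (hg : Measurable g)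
    {k : ENNReal} (hk : ∀ z, k ≤ f z * g z) :
    (∫⁻ z, r z ^ (1 / 2 : ℝ) ∂Q) ^ 2 * k ≤ (∫⁻ z, r z * f z ∂Q) * ∫⁻ z, g z ∂Q := by
  have h1 : k ^ (1 / 2 : ℝ) * ∫⁻ z, r z ^ (1 / 2 : ℝ) ∂Q ≤
      (∫⁻ z, r z * f z ∂Q) ^ (1 / 2 : ℝ) * (∫⁻ z, g z ∂Q) ^ (1 / 2 : ℝ) := by
    rw [← lintegral_const_mul _ (hr.pow_const _)]
    refine le_trans (lintegral_mono fun z => ?_)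
      (ENNReal.lintegral_mul_norm_pow_le (hr.mul hf).aemeasurable hg.aemeasurable
        (by norm_num) (by norm_num) (by norm_num))
    simp only [Pi.mul_apply]
    rw [← ENNReal.mul_rpow_of_nonneg _ _ (by norm_num),
      ← ENNReal.mul_rpow_of_nonneg _ _ (by norm_num)]
    refine ENNReal.rpow_le_rpow ?_ (by norm_num)
    calc k * r z ≤ f z * g z * r z := by gcongr; exact hk z
      _ = r z * f z * g z := by ring
  have h2 := pow_le_pow_left₀ zero_le h1 2
  rw [mul_pow, mul_pow, sq_rpow_half, sq_rpow_half, sq_rpow_half] at h2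
  rwa [mul_comm]

/-- The defect (1 + ρ)/2 - √ρ equals (1 - √ρ)²/2, which is at most (1 - ρ)²/2 because 1 + √ρ ≥ 1. -/
theorem half_one_add_le_sqrt_add {ρ e : ℝ} (hρ : 0 ≤ ρ) (h1 : ρ ≤ 1 + e)
    (h2 : 1 ≤ (1 + e) * ρ) :
    (1 + ρ) / 2 ≤ √ρ + e ^ 2 / 2 := by
  have h3 : (ρ - 1) ^ 2 ≤ e ^ 2 := by
    apply sq_le_sq'
    · nlinarith
    · linarith
  obtain ⟨s, hs, rfl⟩ : ∃ s : ℝ, 0 ≤ s ∧ ρ = s ^ 2 := ⟨√ρ, Real.sqrt_nonneg _, (Real.sq_sqrt hρ).symm⟩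
  rw [Real.sqrt_sq hs]
  nlinarith [mul_nonneg (sq_nonneg (1 - s)) (mul_nonneg hs (by linarith : 0 ≤ s + 2))]

theorem half_one_add_le_rpow_half_add {r : ENNReal} {e : ℝ} (he : 0 ≤ e)
    (h1 : r ≤ ENNReal.ofReal (1 + e)) (h2 : 1 ≤ ENNReal.ofReal (1 + e) * r) :
    (1 + r) / 2 ≤ r ^ (1 / 2 : ℝ) + ENNReal.ofReal (e ^ 2 / 2) := by
  obtain ⟨ρ, hρ, rfl⟩ : ∃ ρ : ℝ, 0 ≤ ρ ∧ r = ENNReal.ofReal ρ :=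
    ⟨r.toReal, ENNReal.toReal_nonneg,
      (ENNReal.ofReal_toReal (ne_top_of_le_ne_top ENNReal.ofReal_ne_top h1)).symm⟩
  have h1' : ρ ≤ 1 + e := (ENNReal.ofReal_le_ofReal_iff (by linarith)).1 h1
  have h2' : 1 ≤ (1 + e) * ρ := by
    rw [← ENNReal.ofReal_mul (by linarith)] at h2
    exact ENNReal.one_le_ofReal.1 h2
  have h3 : (1 + ENNReal.ofReal ρ) / 2 = ENNReal.ofReal ((1 + ρ) / 2) := by
    rw [ENNReal.ofReal_div_of_pos (by norm_num), ENNReal.ofReal_add (by norm_num) hρ]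
    simp
  have h4 : ENNReal.ofReal ρ ^ (1 / 2 : ℝ) = ENNReal.ofReal (√ρ) := by
    rw [Real.sqrt_eq_rpow, ENNReal.ofReal_rpow_of_nonneg hρ (by norm_num)]
  rw [h3, h4, ← ENNReal.ofReal_add (Real.sqrt_nonneg _) (by positivity)]
  exact ENNReal.ofReal_le_ofReal (half_one_add_le_sqrt_add hρ h1' h2')

theorem exp_neg_le_one_sub_sq {e : ℝ} (he : 0 ≤ e) (he1 : e ≤ 1) :
    Real.exp (-2 * e ^ 2) ≤ (1 - e ^ 2 / 2) ^ 2 := by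
  have h : Real.exp (-e ^ 2) ≤ 1 - e ^ 2 / 2 := by
    have h0 : e ^ 2 ≤ 1 := by nlinarith
    rw [Real.exp_neg, inv_le_comm₀ (Real.exp_pos _) (by linarith)]
    refine le_trans ?_ (Real.add_one_le_exp _)
    rw [inv_le_iff_one_le_mul₀ (by linarith)]
    nlinarith [sq_nonneg e]
  calc Real.exp (-2 * e ^ 2) = Real.exp (-e ^ 2) ^ 2 := by
        rw [← Real.exp_nat_mul]; congr 1; push_cast; ring
    _ ≤ _ := pow_le_pow_left₀ (Real.exp_pos _).le h 2

/-- Two probability measures with likelihood ratio in `[1/(1+e), 1+e]` have squared affinity at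
least `exp (-2 e²)`. -/
theorem affinityBound_of_le_smul {Z : Type*} [MeasurableSpace Z] {P Q : Measure Z}
    [IsProbabilityMeasure P] [IsProbabilityMeasure Q] {e : ℝ} (he : 0 ≤ e) (he1 : e ≤ 1)
    (hPQ : ∀ S, MeasurableSet S → P S ≤ ENNReal.ofReal (1 + e) * Q S)
    (hQP : ∀ S, MeasurableSet S → Q S ≤ ENNReal.ofReal (1 + e) * P S) :
    AffinityBound (ENNReal.ofReal (Real.exp (-2 * e ^ 2))) P Q := by
  intro f g hf hg k hk
  have hac : P ≪ Q := Measure.AbsolutelyContinuous.mk fun S hS h0 => by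
    have := hPQ S hS
    rw [h0, mul_zero] at this
    exact le_antisymm this zero_le
  set r := P.rnDeriv Q with hr
  have hrm : Measurable r := Measure.measurable_rnDeriv _ _
  have hset : ∀ S, ∫⁻ z in S, r z ∂Q = P S := fun S => Measure.setLIntegral_rnDeriv hac S
  have hr1 : ∀ᵐ z ∂Q, r z ≤ ENNReal.ofReal (1 + e) := by
    refine ae_le_of_forall_setLIntegral_le_of_sigmaFinite hrm fun S hS _ => ?_
    rw [hset, setLIntegral_const]
    exact hPQ S hS
  have hr2 : ∀ᵐ z ∂Q, 1 ≤ ENNReal.ofReal (1 + e) * r z := by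
    refine ae_le_of_forall_setLIntegral_le_of_sigmaFinite measurable_const fun S hS _ => ?_
    rw [lintegral_const_mul _ hrm, hset, setLIntegral_const, one_mul]
    exact hQP S hS
  -- Since P and Q both have mass 1, (1 + r)/2 has Q-mean 1, and the pointwise defect is at most
  -- e²/2.
  have hint : 1 ≤ ∫⁻ z, r z ^ (1 / 2 : ℝ) ∂Q + ENNReal.ofReal (e ^ 2 / 2) := by
    calc (1 : ENNReal) = ∫⁻ z, (1 + r z) / 2 ∂Q := by
          simp_rw [div_eq_mul_inv]
          rw [lintegral_mul_const _ (hrm.const_add _), lintegral_add_left measurable_const,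
            lintegral_const, ← setLIntegral_univ, hset, measure_univ, measure_univ, one_mul,
            one_add_one_eq_two, ENNReal.mul_inv_cancel (by norm_num) (by norm_num)]
      _ ≤ ∫⁻ z, (r z ^ (1 / 2 : ℝ) + ENNReal.ofReal (e ^ 2 / 2)) ∂Q := by
          refine lintegral_mono_ae ?_
          filter_upwards [hr1, hr2] with z h1 h2
          exact half_one_add_le_rpow_half_add he h1 h2
      _ = _ := by
          rw [lintegral_add_right _ measurable_const, lintegral_const, measure_univ, mul_one]
  have hint' : ENNReal.ofReal (1 - e ^ 2 / 2) ≤ ∫⁻ z, r z ^ (1 / 2 : ℝ) ∂Q := by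
    rw [ENNReal.ofReal_sub _ (by positivity), ENNReal.ofReal_one]
    exact tsub_le_iff_right.2 hint
  calc ENNReal.ofReal (Real.exp (-2 * e ^ 2)) * k
      ≤ (∫⁻ z, r z ^ (1 / 2 : ℝ) ∂Q) ^ 2 * k := by
        gcongr
        refine le_trans (ENNReal.ofReal_le_ofReal (exp_neg_le_one_sub_sq he he1)) ?_
        rw [ENNReal.ofReal_pow (by nlinarith)]
        gcongr
    _ ≤ (∫⁻ z, r z * f z ∂Q) * ∫⁻ z, g z ∂Q := sq_lintegral_rpow_half_mul_le hrm hf hg hk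
    _ = _ := by rw [lintegral_rnDeriv_mul hac hf.aemeasurable]

/-- Two probability measures with squared affinity at least `c` have total variation distance at
most `√(1 - c)`. -/
theorem AffinityBound.tvBound {Z : Type*} [MeasurableSpace Z] {P Q : Measure Z}
    [IsProbabilityMeasure P] [IsProbabilityMeasure Q] {c v : ℝ} (hc : 0 < c) (hv : 0 ≤ v)
    (hcv : 1 - c ≤ v ^ 2) (h : AffinityBound (ENNReal.ofReal c) P Q) :
    TVBound (ENNReal.ofReal v) P Q := by
  intro φ hφ hφ1
  have hP1 : ∫⁻ z, φ z ∂P ≤ 1 := by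
    simpa using lintegral_mono (μ := P) hφ1
  have hQ1 : ∫⁻ z, φ z ∂Q ≤ 1 := by
    simpa using lintegral_mono (μ := Q) hφ1
  have hsub : ∫⁻ z, (1 - φ z) ∂P = 1 - ∫⁻ z, φ z ∂P := by
    rw [lintegral_sub hφ (ne_top_of_le_ne_top ENNReal.one_ne_top hP1)
      (Filter.Eventually.of_forall hφ1)]
    simp
  obtain ⟨p, hp, hpe⟩ : ∃ p : ℝ, 0 ≤ p ∧ ∫⁻ z, φ z ∂P = ENNReal.ofReal p :=
    ⟨_, ENNReal.toReal_nonneg, (ENNReal.ofReal_toReal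
      (ne_top_of_le_ne_top ENNReal.one_ne_top hP1)).symm⟩
  obtain ⟨q, hq, hqe⟩ : ∃ q : ℝ, 0 ≤ q ∧ ∫⁻ z, φ z ∂Q = ENNReal.ofReal q :=
    ⟨_, ENNReal.toReal_nonneg, (ENNReal.ofReal_toReal
      (ne_top_of_le_ne_top ENNReal.one_ne_top hQ1)).symm⟩
  have hp1 : p ≤ 1 := by rw [hpe] at hP1; exact ENNReal.ofReal_le_one.1 hP1
  have hq1 : q ≤ 1 := by rw [hqe] at hQ1; exact ENNReal.ofReal_le_one.1 hQ1
  -- The functions 1 - φ + t and φ + t have product φ(1 - φ) + t + t², hence at least t + t²; the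
  -- shift t keeps this bound positive where φ is 0 or 1.
  have key : ∀ t : ℝ, 0 ≤ t → c * (t + t ^ 2) ≤ (1 - p + t) * (q + t) := by
    intro t ht
    have := h (fun z => (1 - φ z) + ENNReal.ofReal t) (fun z => φ z + ENNReal.ofReal t)
      ((measurable_const.sub hφ).add_const _) (hφ.add_const _)
      (ENNReal.ofReal t + ENNReal.ofReal t ^ 2) (fun z => by
        have h1 : (1 - φ z) + φ z = 1 := tsub_add_cancel_of_le (hφ1 z)
        calc ENNReal.ofReal t + ENNReal.ofReal t ^ 2
            = ((1 - φ z) + φ z) * ENNReal.ofReal t + ENNReal.ofReal t ^ 2 := by rw [h1, one_mul]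
          _ ≤ (1 - φ z) * φ z + (((1 - φ z) + φ z) * ENNReal.ofReal t
                + ENNReal.ofReal t ^ 2) := le_add_self
          _ = _ := by ring)
    rw [lintegral_add_right _ measurable_const, lintegral_add_right _ measurable_const, hsub, hpe,
      hqe, lintegral_const, lintegral_const, measure_univ, measure_univ, mul_one,
      ← ENNReal.ofReal_one, ← ENNReal.ofReal_sub _ hp, ← ENNReal.ofReal_add (by linarith) ht,
      ← ENNReal.ofReal_add hq ht, ← ENNReal.ofReal_pow ht, ← ENNReal.ofReal_add ht (by positivity),
      ← ENNReal.ofReal_mul hc.le, ← ENNReal.ofReal_mul (by linarith)] at this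
    exact (ENNReal.ofReal_le_ofReal_iff (mul_nonneg (by linarith) (by linarith))).1 this
  rw [hpe, hqe, ← ENNReal.ofReal_add hq hv]
  refine ENNReal.ofReal_le_ofReal ?_
  by_contra! hlt
  set w := p - q with hw
  have hwv : v < w := by linarith
  have hw0 : 0 < w := by linarith
  have hw1 : w ≤ 1 := by linarith
  have hww : 1 - c < w ^ 2 := by nlinarith
  -- AM–GM on the right side of `key`, whose factors sum to 1 + 2t - w.
  have h4 : ∀ t : ℝ, 0 ≤ t → c * ((1 + 2 * t) ^ 2 - 1) ≤ (1 + 2 * t - w) ^ 2 := by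
    intro t ht
    nlinarith [key t ht, sq_nonneg (1 - p - q)]
  -- With s = 1 + 2t, the ratio (s - w)²/(s² - 1) is smallest at s = 1/w, where it equals 1 - w².
  have h5 := h4 ((1 / w - 1) / 2) (by
    have : 1 ≤ 1 / w := by rw [le_div_iff₀ hw0]; linarith
    linarith)
  have h6 : 1 + 2 * ((1 / w - 1) / 2) = 1 / w := by ring
  rw [h6] at h5
  have h7 : c * (1 - w ^ 2) ≤ (1 - w ^ 2) ^ 2 := by
    have := mul_le_mul_of_nonneg_right h5 (sq_nonneg w)
    field_simp at this
    linarith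
  rcases hw1.lt_or_eq with hlt1 | heq
  · have : 0 < 1 - w ^ 2 := by nlinarith
    nlinarith
  -- For w = 1 the optimal t degenerates to 0; t = c already gives 4c²(1 + c) ≤ 4c², a
  -- contradiction.
  · have h8 := h4 c hc.le
    rw [heq] at h8
    nlinarith [mul_pos hc hc]

/-! ### Tensorization along sequences -/

/-- A measure on sequences of length `n + 1` is the law of a sequence of length `n` with law `P`
followed by a last entry drawn from `K`. -/
def IsSnocLaw {Z : Type*} [MeasurableSpace Z] {n : ℕ} (P' : Measure (Fin (n + 1) → Z))
    (P : Measure (Fin n → Z)) (K : Kernel (Fin n → Z) Z) : Prop :=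
  ∀ f : (Fin (n + 1) → Z) → ENNReal, Measurable f →
    ∫⁻ z, f z ∂P' = ∫⁻ z, ∫⁻ w, f (Fin.snoc z w) ∂K z ∂P

theorem measurable_snoc {Z : Type*} [MeasurableSpace Z] (n : ℕ) :
    Measurable (fun p : (Fin n → Z) × Z => (Fin.snoc p.1 p.2 : Fin (n + 1) → Z)) := by
  refine measurable_pi_lambda _ fun i => ?_
  refine Fin.lastCases ?_ (fun j => ?_) i
  · simpa using measurable_snd
  · simp only [Fin.snoc_castSucc]
    fun_prop

/-- The inner integrals of f and g over the last entry are functions of z with product at least d·k,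
so they are test functions for the bound on P and Q. -/
theorem AffinityBound.snoc {Z : Type*} [MeasurableSpace Z] {n : ℕ}
    {P' Q' : Measure (Fin (n + 1) → Z)} {P Q : Measure (Fin n → Z)} {K L : Kernel (Fin n → Z) Z}
    [IsSFiniteKernel K] [IsSFiniteKernel L]
    (hP : IsSnocLaw P' P K) (hQ : IsSnocLaw Q' Q L) {c d : ENNReal}
    (h : AffinityBound c P Q) (hK : ∀ z, AffinityBound d (K z) (L z)) :
    AffinityBound (c * d) P' Q' := by
  intro f g hf hg k hk
  have hf' := hf.comp (measurable_snoc (Z := Z) n)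
  have hg' := hg.comp (measurable_snoc (Z := Z) n)
  rw [hP f hf, hQ g hg, mul_assoc]
  refine h _ _ hf'.lintegral_kernel_prod_right' hg'.lintegral_kernel_prod_right' _ fun z => ?_
  exact hK z _ _ (hf'.comp measurable_prodMk_left) (hg'.comp measurable_prodMk_left) k
    fun w => hk _

theorem lintegral_pi_snoc {X : Type*} [MeasurableSpace X] (ν : Measure X) [SigmaFinite ν] (n : ℕ)
    {f : (Fin (n + 1) → X) → ENNReal} (hf : Measurable f) :
    ∫⁻ x, f x ∂(Measure.pi fun _ : Fin (n + 1) => ν) =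
      ∫⁻ x, ∫⁻ y, f (Fin.snoc x y) ∂ν ∂(Measure.pi fun _ : Fin n => ν) := by
  have h := (measurePreserving_piFinSuccAbove (fun _ : Fin (n + 1) => ν) (Fin.last n)).symm
  rw [← h.lintegral_comp hf, lintegral_prod_symm _ (by fun_prop)]
  refine lintegral_congr fun x => lintegral_congr fun y => ?_
  congr 1
  simp [MeasurableEquiv.piFinSuccAbove, Fin.insertNthEquiv]

theorem AffinityBound.of_isEmpty_index {Z : Type*} [MeasurableSpace Z]
    {P Q : Measure (Fin 0 → Z)} [IsProbabilityMeasure P] [IsProbabilityMeasure Q] :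
    AffinityBound 1 P Q := by
  intro f g _ _ k hk
  rw [lintegral_unique, lintegral_unique]
  simpa using hk _

theorem AffinityBound.pi {X : Type*} [MeasurableSpace X] {μ ν : Measure X}
    [IsProbabilityMeasure μ] [IsProbabilityMeasure ν] {c : ENNReal} (h : AffinityBound c μ ν)
    (m : ℕ) :
    AffinityBound (c ^ m) (Measure.pi fun _ : Fin m => μ) (Measure.pi fun _ : Fin m => ν) := by
  induction m with
  | zero => simpa using AffinityBound.of_isEmpty_index
  | succ m ih =>
    rw [pow_succ]
    exact AffinityBound.snoc (K := Kernel.const _ μ) (L := Kernel.const _ ν)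
      (fun f hf => lintegral_pi_snoc μ m hf) (fun f hf => lintegral_pi_snoc ν m hf) ih
      fun _ => h

/-! ### Contraction by a private channel -/

theorem TVBound.lintegral_le {X : Type*} [MeasurableSpace X] {V : ENNReal} {P Q : Measure X}
    (h : TVBound V P Q) {φ : X → ENNReal} (hφ : Measurable φ) {b : ENNReal} (hb : b ≠ ⊤)
    (hφb : ∀ x, φ x ≤ b) : ∫⁻ x, φ x ∂P ≤ ∫⁻ x, φ x ∂Q + V * b := by
  rcases eq_or_ne b 0 with rfl | hb0
  · have : φ = fun _ => 0 := funext fun x => le_antisymm (hφb x) zero_le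
    simp [this]
  have h1 := h (fun x => φ x / b) (hφ.div_const b) fun x => ENNReal.div_le_of_le_mul (by
    rw [one_mul]; exact hφb x)
  simp_rw [div_eq_mul_inv] at h1
  rw [lintegral_mul_const _ hφ, lintegral_mul_const _ hφ] at h1
  have h2 := mul_le_mul_left h1 b
  rwa [add_mul, mul_assoc, mul_assoc, ENNReal.inv_mul_cancel hb0 hb, mul_one, mul_one] at h2

/-- A channel whose outputs have likelihood ratios at most `1 + e` contracts total variation
distance at most `v` to likelihood ratio at most `1 + e v`. -/
theorem TVBound.lintegral_le_of_ldp {X : Type*} [MeasurableSpace X] {P Q : Measure X}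
    [IsProbabilityMeasure P] [IsProbabilityMeasure Q] {v e : ℝ} (hv : 0 ≤ v) (he : 0 ≤ e)
    (h : TVBound (ENNReal.ofReal v) P Q) {q : X → ENNReal} (hq : Measurable q)
    (hq1 : ∀ x, q x ≤ 1) (hldp : ∀ x x', q x ≤ ENNReal.ofReal (1 + e) * q x') :
    ∫⁻ x, q x ∂P ≤ ENNReal.ofReal (1 + e * v) * ∫⁻ x, q x ∂Q := by
  -- Privacy confines q - I to [0, eI], so changing P to Q costs at most v·e·I, and I is at most the
  -- Q-mean of q.
  set I := ⨅ x, q x with hI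
  have hIq : ∀ x, I ≤ q x := fun x => iInf_le _ x
  have hne : Nonempty X := nonempty_of_isProbabilityMeasure P
  have hItop : I ≠ ⊤ := ne_top_of_le_ne_top ENNReal.one_ne_top ((hIq hne.some).trans (hq1 _))
  have hqI : ∀ x, q x ≤ I + ENNReal.ofReal e * I := fun x => by
    have : q x ≤ ENNReal.ofReal (1 + e) * I := by
      rw [hI, ENNReal.mul_iInf_of_ne (by positivity) ENNReal.ofReal_ne_top]
      exact le_iInf fun x' => hldp x x'
    rwa [ENNReal.ofReal_add zero_le_one he, ENNReal.ofReal_one, add_mul, one_mul] at this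
  have hsplit : ∀ (ρ : Measure X) [IsProbabilityMeasure ρ],
      ∫⁻ x, q x ∂ρ = ∫⁻ x, (q x - I) ∂ρ + I := fun ρ _ => by
    calc ∫⁻ x, q x ∂ρ = ∫⁻ x, ((q x - I) + I) ∂ρ :=
          lintegral_congr fun x => (tsub_add_cancel_of_le (hIq x)).symm
      _ = _ := by rw [lintegral_add_right _ measurable_const]; simp
  have hIle : I ≤ ∫⁻ x, q x ∂Q := by rw [hsplit Q]; exact le_add_self
  have h1 := h.lintegral_le (hq.sub_const I) (ENNReal.mul_ne_top ENNReal.ofReal_ne_top hItop)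
    fun x => tsub_le_iff_left.2 (hqI x)
  calc ∫⁻ x, q x ∂P = ∫⁻ x, (q x - I) ∂P + I := hsplit P
    _ ≤ ∫⁻ x, (q x - I) ∂Q + ENNReal.ofReal v * (ENNReal.ofReal e * I) + I := by gcongr
    _ = ∫⁻ x, q x ∂Q + ENNReal.ofReal (e * v) * I := by
        rw [hsplit Q, ENNReal.ofReal_mul he]; ring
    _ ≤ ∫⁻ x, q x ∂Q + ENNReal.ofReal (e * v) * ∫⁻ x, q x ∂Q := by gcongr
    _ = _ := by
        rw [ENNReal.ofReal_add zero_le_one (by positivity), ENNReal.ofReal_one, add_mul, one_mul]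

/-! ### Affinity of the sequence of releases -/

/-- The conditional law of a release given the earlier ones, when the private data have law `ν`. -/
def marginalChannel {X Z W : Type*} [MeasurableSpace X] [MeasurableSpace Z] [MeasurableSpace W]
    (κ : Kernel (X × W) Z) (ν : Measure X) : Kernel W Z :=
  κ ∘ₖ (Kernel.const W ν ×ₖ Kernel.id)

section marginalChannel

variable {X Z W : Type*} [MeasurableSpace X] [MeasurableSpace Z] [MeasurableSpace W]
  (κ : Kernel (X × W) Z) (ν : Measure X)

instance [IsMarkovKernel κ] [IsProbabilityMeasure ν] : IsMarkovKernel (marginalChannel κ ν) := by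
  unfold marginalChannel; infer_instance

theorem lintegral_marginalChannel [SFinite ν] (w : W) {f : Z → ENNReal} (hf : Measurable f) :
    ∫⁻ z, f z ∂(marginalChannel κ ν w) = ∫⁻ x, ∫⁻ z, f z ∂κ (x, w) ∂ν := by
  rw [marginalChannel, Kernel.lintegral_comp _ _ _ hf,
    Kernel.lintegral_prod_id (hf.lintegral_kernel)]
  rfl

theorem marginalChannel_apply [SFinite ν] (w : W) {S : Set Z} (hS : MeasurableSet S) :
    marginalChannel κ ν w S = ∫⁻ x, κ (x, w) S ∂ν := by
  have := lintegral_marginalChannel κ ν w (measurable_const.indicator hS : Measurable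
    (S.indicator fun _ => (1 : ENNReal)))
  simpa [lintegral_indicator hS] using this

end marginalChannel

theorem affinityBound_marginalChannel {X Z W : Type*} [MeasurableSpace X] [MeasurableSpace Z]
    [MeasurableSpace W] {κ : Kernel (X × W) Z} [IsMarkovKernel κ] {P Q : Measure X}
    [IsProbabilityMeasure P] [IsProbabilityMeasure Q] {v e : ℝ} (hv : 0 ≤ v) (he : 0 ≤ e)
    (hev : e * v ≤ 1) (hPQ : TVBound (ENNReal.ofReal v) P Q) (hQP : TVBound (ENNReal.ofReal v) Q P)
    (hldp : ∀ (w : W) (x x' : X) (S : Set Z), MeasurableSet S →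
      κ (x, w) S ≤ ENNReal.ofReal (1 + e) * κ (x', w) S) (w : W) :
    AffinityBound (ENNReal.ofReal (Real.exp (-2 * (e * v) ^ 2)))
      (marginalChannel κ P w) (marginalChannel κ Q w) := by
  have hm : ∀ S, MeasurableSet S → Measurable fun x => κ (x, w) S := fun S hS =>
    (Kernel.measurable_coe κ hS).comp measurable_prodMk_right
  refine affinityBound_of_le_smul (by positivity) hev (fun S hS => ?_) fun S hS => ?_
  all_goals
    rw [marginalChannel_apply _ _ _ hS, marginalChannel_apply _ _ _ hS]
  · exact hPQ.lintegral_le_of_ldp hv he (hm S hS) (fun _ => prob_le_one)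
      fun x x' => hldp w x x' S hS
  · exact hQP.lintegral_le_of_ldp hv he (hm S hS) (fun _ => prob_le_one)
      fun x x' => hldp w x x' S hS

theorem isMarkovKernel_releaseKernel {X Z : Type*} [MeasurableSpace X] [MeasurableSpace Z] (n : ℕ)
    (κ : (u : Fin n) → Kernel (X × (Fin (u : ℕ) → Z)) Z) (hκ : ∀ u, IsMarkovKernel (κ u)) :
    IsMarkovKernel (releaseKernel n κ) := by
  induction n with
  | zero => unfold releaseKernel; infer_instance
  | succ n ih =>
    have := ih (fun u => κ u.castSucc) fun u => hκ _
    have := hκ (Fin.last n)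
    unfold releaseKernel
    exact Kernel.IsMarkovKernel.map _ (measurable_snoc n)

/-- The last user's data are independent of the earlier data and releases, so they can be integrated
out for each fixed history of releases. -/
theorem isSnocLaw_releaseKernel {X Z : Type*} [MeasurableSpace X] [MeasurableSpace Z] {n : ℕ}
    (κ : (u : Fin (n + 1)) → Kernel (X × (Fin (u : ℕ) → Z)) Z) (hκ : ∀ u, IsMarkovKernel (κ u))
    (ν : Measure X) [IsProbabilityMeasure ν] :
    IsSnocLaw ((Measure.pi fun _ : Fin (n + 1) => ν).bind (releaseKernel (n + 1) κ))
      ((Measure.pi fun _ : Fin n => ν).bind (releaseKernel n fun u => κ u.castSucc))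
      (marginalChannel (W := Fin n → Z) (κ (Fin.last n)) ν) := by
  intro f hf
  have := isMarkovKernel_releaseKernel n (fun u => κ u.castSucc) fun u => hκ _
  have hlast := hκ (Fin.last n)
  set κ' : Kernel (X × (Fin n → Z)) Z := κ (Fin.last n) with hκ'
  have : IsMarkovKernel κ' := hlast
  have hf' : Measurable fun p : (Fin n → Z) × Z => f (Fin.snoc p.1 p.2) :=
    hf.comp (measurable_snoc n)
  have hF : Measurable fun p : X × (Fin n → Z) => ∫⁻ w, f (Fin.snoc p.2 w) ∂κ' p :=
    Measurable.lintegral_kernel_prod_right' (κ := κ')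
      (f := fun p : (X × (Fin n → Z)) × Z => f (Fin.snoc p.1.2 p.2))
      (hf'.comp ((measurable_snd.comp measurable_fst).prodMk measurable_snd))
  rw [Measure.lintegral_bind (Kernel.aemeasurable _) hf.aemeasurable,
    Measure.lintegral_bind (Kernel.aemeasurable _)
      (hf'.lintegral_kernel_prod_right').aemeasurable,
    lintegral_pi_snoc _ _ hf.lintegral_kernel]
  refine lintegral_congr fun x => ?_
  have h1 : ∀ y : X, ∫⁻ z, f z ∂(releaseKernel (n + 1) κ (Fin.snoc x y)) =
      ∫⁻ z, ∫⁻ w, f (Fin.snoc z w) ∂κ' (y, z) ∂(releaseKernel n (fun u => κ u.castSucc) x) := by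
    intro y
    rw [releaseKernel, Kernel.map_apply _ (measurable_snoc n), lintegral_map hf (measurable_snoc n),
      Kernel.lintegral_compProd _ _ _ hf', Kernel.comap_apply]
    simp [Kernel.comap_apply, hκ']
  simp_rw [h1]
  rw [lintegral_lintegral_swap hF.aemeasurable]
  refine lintegral_congr fun z => ?_
  exact (lintegral_marginalChannel _ _ _ (hf'.comp measurable_prodMk_left)).symm

theorem affinityBound_bind_releaseKernel {X Z : Type*} [MeasurableSpace X] [MeasurableSpace Z]
    {P Q : Measure X} [IsProbabilityMeasure P] [IsProbabilityMeasure Q] {v e : ℝ} (hv : 0 ≤ v)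
    (he : 0 ≤ e) (hev : e * v ≤ 1)
    (hPQ : TVBound (ENNReal.ofReal v) P Q) (hQP : TVBound (ENNReal.ofReal v) Q P) (n : ℕ)
    (κ : (u : Fin n) → Kernel (X × (Fin (u : ℕ) → Z)) Z) (hκ : ∀ u, IsMarkovKernel (κ u))
    (hldp : ∀ (u : Fin n) (z : Fin (u : ℕ) → Z) (x x' : X) (S : Set Z), MeasurableSet S →
      κ u (x, z) S ≤ ENNReal.ofReal (1 + e) * κ u (x', z) S) :
    AffinityBound (ENNReal.ofReal (Real.exp (-2 * (e * v) ^ 2)) ^ n)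
      ((Measure.pi fun _ : Fin n => P).bind (releaseKernel n κ))
      ((Measure.pi fun _ : Fin n => Q).bind (releaseKernel n κ)) := by
  induction n with
  | zero =>
    have := isMarkovKernel_releaseKernel 0 κ hκ
    simpa using AffinityBound.of_isEmpty_index
  | succ n ih =>
    have := hκ (Fin.last n)
    rw [pow_succ]
    exact AffinityBound.snoc
      (K := marginalChannel (W := Fin n → Z) (κ (Fin.last n)) P)
      (L := marginalChannel (W := Fin n → Z) (κ (Fin.last n)) Q)
      (isSnocLaw_releaseKernel κ hκ P) (isSnocLaw_releaseKernel κ hκ Q)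
      (ih _ (fun u => hκ _) fun u => hldp u.castSucc)
      (affinityBound_marginalChannel hv he hev hPQ hQP (hldp (Fin.last n)))

/-! ### Total variation between data set laws -/

theorem tvBound_one {X : Type*} [MeasurableSpace X] (P Q : Measure X) [IsProbabilityMeasure P] :
    TVBound 1 P Q := fun h _ h1 =>
  calc ∫⁻ x, h x ∂P ≤ ∫⁻ _, 1 ∂P := lintegral_mono h1
    _ = 1 := by simp
    _ ≤ _ := le_add_self

theorem TVBound.min_one {X : Type*} [MeasurableSpace X] {P Q : Measure X} [IsProbabilityMeasure P]
    {v : ℝ} (h : TVBound (ENNReal.ofReal v) P Q) : TVBound (ENNReal.ofReal (min v 1)) P Q := by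
  rcases min_choice v 1 with hv | hv <;> rw [hv]
  · exact h
  · simpa using tvBound_one P Q

/-- Product measures of two measures with squared affinity at least `exp (-2 e²)` have total
variation distance at most `√(2 m) e`. -/
theorem AffinityBound.tvBound_pi {X : Type*} [MeasurableSpace X] {μ ν : Measure X}
    [IsProbabilityMeasure μ] [IsProbabilityMeasure ν] {e : ℝ} (he : 0 ≤ e)
    (h : AffinityBound (ENNReal.ofReal (Real.exp (-2 * e ^ 2))) μ ν) (m : ℕ) :
    TVBound (ENNReal.ofReal (√2 * e * √m)) (Measure.pi fun _ : Fin m => μ)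
      (Measure.pi fun _ : Fin m => ν) := by
  have h1 := h.pi m
  rw [← ENNReal.ofReal_pow (Real.exp_pos _).le, ← Real.exp_nat_mul] at h1
  refine h1.tvBound (Real.exp_pos _) (by positivity) ?_
  rw [mul_pow, mul_pow, Real.sq_sqrt (by norm_num), Real.sq_sqrt (by positivity)]
  linarith [Real.add_one_le_exp ((m : ℝ) * (-2 * e ^ 2))]

theorem measurable_sigmaMk {ι : Type*} {X : ι → Type*} [∀ i, MeasurableSpace (X i)] (i : ι) :
    Measurable (Sigma.mk i : X i → Σ i, X i) :=
  measurable_iff_le_map.2 (iInf_le (fun i => MeasurableSpace.map (Sigma.mk i) inferInstance) i)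

theorem lintegral_datasetLaw (M : PMF ℕ+) (μ : Measure Sample) {f : Dataset → ENNReal}
    (hf : Measurable f) :
    ∫⁻ x, f x ∂(datasetLaw M μ) =
      ∑' m : ℕ+, M m * ∫⁻ x, f ⟨m, x⟩ ∂(Measure.pi fun _ : Fin (m : ℕ) => μ) := by
  rw [datasetLaw, lintegral_sum_measure]
  refine tsum_congr fun m => ?_
  rw [lintegral_smul_measure, lintegral_map hf (measurable_sigmaMk m), smul_eq_mul]

instance (M : PMF ℕ+) (μ : Measure Sample) [IsProbabilityMeasure μ] :
    IsProbabilityMeasure (datasetLaw M μ) := ⟨by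
  rw [← lintegral_one, lintegral_datasetLaw M μ measurable_const]
  simp [M.tsum_coe]⟩

theorem tsum_ofReal_truncSqrt (M : PMF ℕ+)
    (hM : Summable fun m : ℕ+ => (M m).toReal * ((m : ℕ) : ℝ)) (a : ℕ) :
    ∑' m : ℕ+, M m * ENNReal.ofReal (if (m : ℕ) ≤ a then √((m : ℕ) : ℝ) else 0) =
      ENNReal.ofReal (truncSqrtMoment M a) := by
  have hnn : ∀ m : ℕ+, 0 ≤ (M m).toReal * (if (m : ℕ) ≤ a then √((m : ℕ) : ℝ) else 0) :=
    fun m => mul_nonneg ENNReal.toReal_nonneg (by split_ifs <;> positivity)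
  rw [truncSqrtMoment, ENNReal.ofReal_tsum_of_nonneg hnn]
  · refine tsum_congr fun m => ?_
    rw [ENNReal.ofReal_mul ENNReal.toReal_nonneg, ENNReal.ofReal_toReal (M.apply_ne_top m)]
  -- Without summability the real `tsum` would take the default value 0; √m ≤ m for m ≥ 1 reduces it
  -- to the finite mean.
  · refine Summable.of_nonneg_of_le hnn (fun m => ?_) hM
    refine mul_le_mul_of_nonneg_left ?_ ENNReal.toReal_nonneg
    have hm : (1 : ℝ) ≤ ((m : ℕ) : ℝ) := by exact_mod_cast m.2
    split_ifs
    · exact Real.sqrt_le_iff.2 ⟨by positivity, by nlinarith⟩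
    · positivity

theorem tsum_ofReal_tail (M : PMF ℕ+) (a : ℕ) :
    ∑' m : ℕ+, M m * (if (m : ℕ) ≤ a then 0 else 1) = ENNReal.ofReal (tailProb M a) := by
  have hle : M.toOuterMeasure {m : ℕ+ | a < (m : ℕ)} ≠ ⊤ := by
    refine ne_top_of_le_ne_top ENNReal.one_ne_top ?_
    rw [PMF.toOuterMeasure_apply, ← M.tsum_coe]
    exact ENNReal.tsum_le_tsum fun m => Set.indicator_le_self' (fun _ _ => zero_le) m
  rw [tailProb, ENNReal.ofReal_toReal hle, PMF.toOuterMeasure_apply]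
  refine tsum_congr fun m => ?_
  by_cases h : (m : ℕ) ≤ a
  · simp [h]
  · simp [h, not_le.1 h]

/-- The size has the same law M in both cases, so the distance is at most the M-average of the
distances at fixed size. -/
theorem AffinityBound.tvBound_datasetLaw {μ ν : Measure Sample} [IsProbabilityMeasure μ]
    [IsProbabilityMeasure ν] {e : ℝ} (he : 0 ≤ e)
    (h : AffinityBound (ENNReal.ofReal (Real.exp (-2 * e ^ 2))) μ ν) (M : PMF ℕ+)
    (hM : Summable fun m : ℕ+ => (M m).toReal * ((m : ℕ) : ℝ)) (a : ℕ) :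
    TVBound (ENNReal.ofReal (√2 * e * truncSqrtMoment M a + tailProb M a))
      (datasetLaw M μ) (datasetLaw M ν) := by
  intro φ hφ hφ1
  have hT : 0 ≤ truncSqrtMoment M a := tsum_nonneg fun m =>
    mul_nonneg ENNReal.toReal_nonneg (by split_ifs <;> positivity)
  have hs : ENNReal.ofReal (√2 * e * truncSqrtMoment M a + tailProb M a) =
      ∑' m : ℕ+, M m * (ENNReal.ofReal (√2 * e) *
        ENNReal.ofReal (if (m : ℕ) ≤ a then √((m : ℕ) : ℝ) else 0) +
        if (m : ℕ) ≤ a then 0 else 1) := by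
    rw [ENNReal.ofReal_add (by positivity) (show 0 ≤ tailProb M a from ENNReal.toReal_nonneg),
      ENNReal.ofReal_mul (by positivity),
      ← tsum_ofReal_truncSqrt M hM, ← tsum_ofReal_tail, ← ENNReal.tsum_mul_left,
      ← ENNReal.tsum_add]
    exact tsum_congr fun m => by ring
  rw [lintegral_datasetLaw M μ hφ, lintegral_datasetLaw M ν hφ, hs, ← ENNReal.tsum_add]
  refine ENNReal.tsum_le_tsum fun m => ?_
  rw [← mul_add]
  refine mul_le_mul_right ?_ _
  have hφm : Measurable fun x : Fin (m : ℕ) → Sample => φ ⟨m, x⟩ :=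
    hφ.comp (measurable_sigmaMk m)
  split_ifs with hm
  · rw [← ENNReal.ofReal_mul (by positivity), add_zero]
    exact h.tvBound_pi he m _ hφm fun _ => hφ1 _
  · rw [ENNReal.ofReal_zero, mul_zero, zero_add]
    exact tvBound_one _ _ _ hφm fun _ => hφ1 _

/-! ### The two-point family -/

/-- The distribution on `{-1, 1}` with mean `δ`. -/
def twoPoint (δ : ℝ) : Measure Sample :=
  ENNReal.ofReal ((1 + δ) / 2) • Measure.dirac ⟨1, by norm_num⟩ +
    ENNReal.ofReal ((1 - δ) / 2) • Measure.dirac ⟨-1, by norm_num⟩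

theorem isProbabilityMeasure_twoPoint {δ : ℝ} (hδ : |δ| ≤ 1) :
    IsProbabilityMeasure (twoPoint δ) := ⟨by
  have := abs_le.1 hδ
  simp only [twoPoint, Measure.add_apply, Measure.smul_apply, measure_univ, smul_eq_mul, mul_one]
  rw [← ENNReal.ofReal_add (by linarith) (by linarith)]
  ring_nf
  simp⟩

theorem mean_twoPoint {δ : ℝ} (hδ : |δ| ≤ 1) : mean (twoPoint δ) = δ := by
  have := abs_le.1 hδ
  rw [mean, twoPoint, integral_add_measure, integral_smul_measure, integral_smul_measure,
    integral_dirac, integral_dirac, ENNReal.toReal_ofReal (by linarith),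
    ENNReal.toReal_ofReal (by linarith)]
  · simp only [smul_eq_mul]; ring
  · exact (integrable_dirac (by simp)).smul_measure ENNReal.ofReal_ne_top
  · exact (integrable_dirac (by simp)).smul_measure ENNReal.ofReal_ne_top

/-- The larger atom ratio is (1 + |δ|)/(1 - |δ|) = 1 + 2|δ|/(1 - |δ|), and 1 - |δ| ≥ 3/4. -/
theorem twoPoint_le_smul {δ : ℝ} (hδ : |δ| ≤ 1 / 4) (S : Set Sample) :
    twoPoint δ S ≤ ENNReal.ofReal (1 + 8 / 3 * |δ|) * twoPoint (-δ) S := by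
  have h1 := abs_le.1 hδ
  have h0 := abs_nonneg δ
  have h2 : (1 + δ) / 2 ≤ (1 + 8 / 3 * |δ|) * ((1 + -δ) / 2) := by
    rcases abs_cases δ with ⟨h, _⟩ | ⟨h, _⟩ <;> rw [h] <;> nlinarith
  have h3 : (1 - δ) / 2 ≤ (1 + 8 / 3 * |δ|) * ((1 - -δ) / 2) := by
    rcases abs_cases δ with ⟨h, _⟩ | ⟨h, _⟩ <;> rw [h] <;> nlinarith
  simp only [twoPoint, Measure.add_apply, Measure.smul_apply, smul_eq_mul]
  rw [mul_add, ← mul_assoc, ← mul_assoc, ← ENNReal.ofReal_mul (by positivity),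
    ← ENNReal.ofReal_mul (by positivity)]
  gcongr

theorem affinityBound_twoPoint {δ : ℝ} (hδ : |δ| ≤ 1 / 4) :
    AffinityBound (ENNReal.ofReal (Real.exp (-2 * (8 / 3 * |δ|) ^ 2)))
      (twoPoint δ) (twoPoint (-δ)) := by
  have := isProbabilityMeasure_twoPoint (δ := δ) (by linarith)
  have := isProbabilityMeasure_twoPoint (δ := -δ) (by rw [abs_neg]; linarith)
  refine affinityBound_of_le_smul (by positivity) (by linarith)
    (fun S _ => twoPoint_le_smul hδ S) fun S _ => ?_
  have := twoPoint_le_smul (δ := -δ) (by rwa [abs_neg]) S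
  rwa [abs_neg, neg_neg] at this

/-! ### Le Cam's bound and the constants -/

/-- Le Cam's two-point bound for the quadratic risk in terms of the affinity. -/
theorem AffinityBound.le_of_risk_le {Z : Type*} [MeasurableSpace Z] {P Q : Measure Z}
    [IsProbabilityMeasure P] [IsProbabilityMeasure Q] {c : ℝ} (hc : 0 ≤ c)
    (h : AffinityBound (ENNReal.ofReal c) P Q) {est : Z → ℝ} (hest : Measurable est) (δ : ℝ)
    {R : ENNReal} (hP : ∫⁻ z, ENNReal.ofReal (|est z - δ| ^ 2) ∂P ≤ R)
    (hQ : ∫⁻ z, ENNReal.ofReal (|est z - -δ| ^ 2) ∂Q ≤ R) :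
    ENNReal.ofReal (c * δ ^ 2) ≤ R := by
  set t := c * δ ^ 2 with ht
  have ht0 : 0 ≤ t := by positivity
  -- The product of the two functions is (x² - δ² + t)² + 4δ²t with x the estimate. As t = cδ², the
  -- bound reads (R + t)² ≥ 4t², that is R ≥ t.
  have key := h (fun z => ENNReal.ofReal (|est z - δ| ^ 2) + ENNReal.ofReal t)
    (fun z => ENNReal.ofReal (|est z - -δ| ^ 2) + ENNReal.ofReal t)
    (by fun_prop) (by fun_prop) (ENNReal.ofReal (4 * δ ^ 2 * t)) (fun z => by
      simp only [sq_abs]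
      rw [← ENNReal.ofReal_add (by positivity) ht0, ← ENNReal.ofReal_add (by positivity) ht0,
        ← ENNReal.ofReal_mul (by positivity)]
      refine ENNReal.ofReal_le_ofReal ?_
      nlinarith [sq_nonneg (est z ^ 2 - δ ^ 2 + t)])
  rw [lintegral_add_right _ measurable_const, lintegral_add_right _ measurable_const,
    lintegral_const, lintegral_const, measure_univ, measure_univ, mul_one,
    ← ENNReal.ofReal_mul hc] at key
  have h2 : ENNReal.ofReal (2 * t) ^ 2 ≤ (R + ENNReal.ofReal t) ^ 2 := by
    rw [← ENNReal.ofReal_pow (by positivity)]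
    calc ENNReal.ofReal ((2 * t) ^ 2) = ENNReal.ofReal (c * (4 * δ ^ 2 * t)) := by
          congr 1; rw [ht]; ring
      _ ≤ _ := key
      _ ≤ (R + ENNReal.ofReal t) * (R + ENNReal.ofReal t) := by gcongr
      _ = _ := (sq _).symm
  have h3 := (ENNReal.pow_le_pow_left_iff two_ne_zero).1 h2
  rw [two_mul, ENNReal.ofReal_add ht0 ht0] at h3
  exact (ENNReal.add_le_add_iff_right ENNReal.ofReal_ne_top).1 h3

/-- On [0, 22/35] the convex function exp lies below its chord, of slope at most 7/5 because
exp(22/35) ≤ 47/25 = 1 + (7/5)(22/35). The 35th power reduces this to a numerical bound on e^22. -/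
theorem exp_sub_one_le {α : ℝ} (hα : 0 < α) (hα' : α ≤ 22 / 35) :
    Real.exp α - 1 ≤ 7 / 5 * α := by
  have h1 : Real.exp (22 / 35) ≤ 47 / 25 := by
    refine (pow_le_pow_iff_left₀ (Real.exp_pos _).le (by norm_num)
      (by norm_num : (35 : ℕ) ≠ 0)).1 ?_
    have h2 : Real.exp (22 / 35) ^ 35 = Real.exp 1 ^ 22 := by
      rw [← Real.exp_nat_mul, ← Real.exp_nat_mul]; norm_num
    rw [h2]
    refine (pow_le_pow_left₀ (Real.exp_pos _).le Real.exp_one_lt_d9.le 22).trans ?_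
    norm_num
  have h3 := convexOn_exp.2 (Set.mem_univ 0) (Set.mem_univ (22 / 35))
    (show (0 : ℝ) ≤ 1 - 35 / 22 * α by linarith) (show 0 ≤ 35 / 22 * α by positivity) (by ring)
  have h4 : (1 - 35 / 22 * α) • (0 : ℝ) + (35 / 22 * α) • (22 / 35 : ℝ) = α := by
    simp only [smul_eq_mul]; ring
  rw [h4] at h3
  simp only [smul_eq_mul, Real.exp_zero] at h3
  nlinarith

theorem minimax_lower_bound_le_exp_mul_sq {n α T p B δ e v : ℝ} (hn : 0 ≤ n) (hα : 0 < α)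
    (hB : B = max (n * α ^ 2 * T ^ 2) 1)
    (hδ : δ ^ 2 * (16 * B) = 1) (he : 0 ≤ e) (heα : e ≤ 7 / 5 * α) (hv : 0 ≤ v)
    (hvle : v ≤ √2 * (8 / 3 * δ) * T + p) :
    Real.exp (-9) / 16 * Real.exp (-24 * n * α ^ 2 * p ^ 2) / B ≤
      Real.exp (n * (-2 * (e * v) ^ 2)) * δ ^ 2 := by
  have hB1 : 1 ≤ B := hB ▸ le_max_right _ _
  have hBT : n * α ^ 2 * T ^ 2 ≤ B := hB ▸ le_max_left _ _
  have hδe : δ ^ 2 = 1 / (16 * B) := by rw [eq_div_iff (by positivity)]; exact hδ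
  have hs2 : √2 ^ 2 = 2 := Real.sq_sqrt (by norm_num)
  have hv2 : v ^ 2 ≤ 256 / 9 * (δ ^ 2 * T ^ 2) + 2 * p ^ 2 := by
    have h1 : v ^ 2 ≤ (√2 * (8 / 3 * δ) * T + p) ^ 2 := pow_le_pow_left₀ hv hvle 2
    have h2 : (√2 * (8 / 3 * δ) * T) ^ 2 = 128 / 9 * (δ ^ 2 * T ^ 2) := by
      rw [mul_pow, mul_pow, hs2]; ring
    nlinarith [sq_nonneg (√2 * (8 / 3 * δ) * T - p)]
  have he2 : e ^ 2 ≤ 49 / 25 * α ^ 2 := by nlinarith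
  have hδT : n * α ^ 2 * (δ ^ 2 * T ^ 2) ≤ 1 / 16 := by
    rw [hδe, div_mul_eq_mul_div, one_mul, mul_div_assoc', div_le_iff₀ (by positivity)]
    linarith
  have hev : n * (e * v) ^ 2 ≤ n * (49 / 25 * α ^ 2 * (256 / 9 * (δ ^ 2 * T ^ 2) + 2 * p ^ 2)) := by
    rw [mul_pow]
    gcongr
  have hnp : 0 ≤ n * α ^ 2 * p ^ 2 := by positivity
  -- The exponent costs at most 2·(49/25)·(256/9)/16 < 9 from the truncated moment and 2·(49/25)·2 <
  -- 24 times nα²p² from the tail.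
  have hexp : Real.exp (-9) * Real.exp (-24 * n * α ^ 2 * p ^ 2) ≤
      Real.exp (n * (-2 * (e * v) ^ 2)) := by
    rw [← Real.exp_add]
    refine Real.exp_le_exp.2 ?_
    nlinarith
  calc Real.exp (-9) / 16 * Real.exp (-24 * n * α ^ 2 * p ^ 2) / B
      = Real.exp (-9) * Real.exp (-24 * n * α ^ 2 * p ^ 2) * (1 / (16 * B)) := by
        field_simp
    _ ≤ _ := by rw [hδe]; gcongr

end UserLDP

end

theorem theorem1 (α : ℝ) (hα : 0 < α) (hα' : α ≤ 22 / 35) (n : ℕ) (hn : 0 < n)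
    (M : PMF ℕ+) (hM : Summable fun m : ℕ+ => (M m).toReal * ((m : ℕ) : ℝ)) :
    (⨆ a : ℕ, ENNReal.ofReal
      ((Real.exp (-9) / 16) *
          Real.exp (-24 * (n : ℝ) * α ^ 2 * UserLDP.tailProb M a ^ 2) /
        max ((n : ℝ) * α ^ 2 * UserLDP.truncSqrtMoment M a ^ 2) 1))
      ≤ UserLDP.minimaxRisk.{u} α n M := by
  refine iSup_le fun a => le_iInf fun Z => le_iInf fun _ => le_iInf fun Q => le_iInf fun est =>
    le_iInf fun hest => ?_
  set T := UserLDP.truncSqrtMoment M a with hT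
  set p := UserLDP.tailProb M a with hp
  set B := max ((n : ℝ) * α ^ 2 * T ^ 2) 1 with hB
  have hB1 : 1 ≤ B := le_max_right _ _
  have hT0 : 0 ≤ T := tsum_nonneg fun m =>
    mul_nonneg ENNReal.toReal_nonneg (by split_ifs <;> positivity)
  have hp0 : 0 ≤ p := ENNReal.toReal_nonneg
  obtain ⟨δ, hδ0, hδ⟩ : ∃ δ : ℝ, 0 ≤ δ ∧ δ ^ 2 * (16 * B) = 1 :=
    ⟨√(1 / (16 * B)), Real.sqrt_nonneg _, by
      rw [Real.sq_sqrt (by positivity)]; field_simp⟩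
  have hδ4 : |δ| ≤ 1 / 4 := by
    rw [abs_of_nonneg hδ0]
    nlinarith
  have hδ4' : |-δ| ≤ 1 / 4 := by rwa [abs_neg]
  have hμ := UserLDP.isProbabilityMeasure_twoPoint (δ := δ) (by linarith)
  have hν := UserLDP.isProbabilityMeasure_twoPoint (δ := -δ) (by linarith)
  -- Capping the distance at 1 ensures (e^α - 1)v ≤ 1, as the affinity bound for likelihood ratios
  -- requires.
  have hPQ := ((UserLDP.affinityBound_twoPoint hδ4).tvBound_datasetLaw (by positivity) M hM
    a).min_one
  have hνμ := UserLDP.affinityBound_twoPoint hδ4'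
  rw [neg_neg, abs_neg] at hνμ
  have hQP := (hνμ.tvBound_datasetLaw (by positivity) M hM a).min_one
  rw [abs_of_nonneg hδ0] at hPQ hQP
  set v := min (√2 * (8 / 3 * δ) * T + p) 1 with hv
  have hv0 : 0 ≤ v := le_min (by positivity) zero_le_one
  have he0 : 0 ≤ Real.exp α - 1 := by linarith [Real.add_one_le_exp α]
  have heα := UserLDP.exp_sub_one_le hα hα'
  have hev : (Real.exp α - 1) * v ≤ 1 := mul_le_one₀ (by linarith) hv0 (min_le_right _ _)
  have haff := UserLDP.affinityBound_bind_releaseKernel hv0 he0 hev hPQ hQP n Q.channel Q.isMarkov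
    (by simpa using Q.ldp)
  have hker := UserLDP.isMarkovKernel_releaseKernel n Q.channel Q.isMarkov
  rw [← ENNReal.ofReal_pow (Real.exp_pos _).le, ← Real.exp_nat_mul] at haff
  have hrisk : ∀ s : ℝ, ∀ hs : |s| ≤ 1 / 4,
      ∫⁻ z, ENNReal.ofReal (|est z - s| ^ 2) ∂(UserLDP.releaseLaw Q M (UserLDP.twoPoint s)) ≤
        ⨆ μ : ProbabilityMeasure UserLDP.Sample, UserLDP.risk Q est M (μ : Measure UserLDP.Sample) :=
    fun s hs => by
      have h := UserLDP.isProbabilityMeasure_twoPoint (δ := s) (by linarith)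
      refine le_trans (le_of_eq ?_) (le_iSup _ (⟨UserLDP.twoPoint s, h⟩ : ProbabilityMeasure _))
      simp [UserLDP.risk, UserLDP.mean_twoPoint (δ := s) (by linarith)]
  refine le_trans (ENNReal.ofReal_le_ofReal ?_)
    (haff.le_of_risk_le (Real.exp_pos _).le hest δ (hrisk δ hδ4) (hrisk (-δ) hδ4'))
  exact UserLDP.minimax_lower_bound_le_exp_mul_sq (Nat.cast_nonneg n) hα hB hδ he0 heα hv0 (min_le_left _ _)
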